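/- For each sample size $n$ let $Y_i = X_i^T\beta_0 + \epsilon_i$, $i=1,\dots,n$, where $X_i\in\mathbb{R}^p$, $\beta_0\in\mathbb{R}^p$ has $s_0$ nonzero components, and $p$, $\beta_0$ and the law of the data may depend on $n$. Assume the following. (a) $\epsilon_i=\sigma(X_i)\xi_i$ for a positive function $\sigma$, where $\xi_1,\dots,\xi_n$ are i.i.d. $N(0,1)$ and $(\xi_1,\dots,\xi_n)$ is independent of $(X_1,\dots,X_n)$. (b) $X_1,\dots,X_n$ are i.i.d. $N(0,\Sigma)$, where $C_{\min}\le\lambda_{\min}(\Sigma)$ and $\max_j\Sigma_{j,j}<C_{\max}$ for constants $0<C_{\min},C_{\max}<\infty$ not depending on $n$. (c) $p>\kappa n$ for some constant $0<\kappa<1$, $\log p/n\to0$, and $s_0=o(\sqrt n/(\log p)^2)$. Let $\lambda_0>0$ be deterministic with $\lambda_0\asymp\sqrt{\log p/n}$ as $n\to\infty$ (the ratio is eventually bounded above and away from zero), and let $\hat\beta$ be any minimizer over $\beta\in\mathbb{R}^p$ of $\frac1n\sum_{i=1}^n(Y_i-X_i^T\beta)^2+2\lambda_0\|\beta\|_1$.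 Put $\hat\epsilon_i=Y_i-X_i^T\hat\beta$, $\hat\sigma^2=\frac1n\sum_{i=1}^n\hat\epsilon_i^2$ and $$T=\frac{1}{n\hat\sigma^4}\sum_{i=1}^n(\hat\epsilon_i^2-\hat\sigma^2)^2 .$$ Then, under the null hypothesis of homoskedasticity $\sigma(\cdot)=\sigma_0$, where $\sigma_0>0$ is a constant not depending on $n$, $$\sqrt n\,(T-2)\xrightarrow{d}N(0,24)\qquad(n\to\infty).$$ -/

import Mathlib

open MeasureTheory ProbabilityTheory Filter Asymptotics Topology

/-- A linear regression model `Y i = ⟪X i, β₀⟫ + ε i`, `i = 1, …, n`, with `p` covariates, on a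
sample space `Ω`: covariates, regression coefficient, conditional standard deviation function,
errors. The distributional assumptions are stated separately. -/
structure RegressionModel (n p : ℕ) (Ω : Type*) where
  /-- the covariate vectors -/
  X : Fin n → Ω → EuclideanSpace ℝ (Fin p)
  /-- the true regression coefficient -/
  β₀ : EuclideanSpace ℝ (Fin p)
  /-- the conditional standard deviation of an error given its covariate -/
  σ : EuclideanSpace ℝ (Fin p) → ℝ
  σ_pos : ∀ x, 0 < σ x
  /-- the errors -/
  ε : Fin n → Ω → ℝ

namespace RegressionModel

variable {n p : ℕ} {Ω : Type*}

/-- The responses. -/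
noncomputable def Y (M : RegressionModel n p Ω) (i : Fin n) (ω : Ω) : ℝ :=
  inner ℝ (M.X i ω) M.β₀ + M.ε i ω

/-- The sparsity `s₀`: the number of nonzero components of `β₀`. -/
noncomputable def s₀ (M : RegressionModel n p Ω) : ℕ :=
  Set.ncard {j : Fin p | M.β₀ j ≠ 0}

/-- Conditionally Gaussian errors: `ε i = σ (X i) ξ i` with `ξ i` i.i.d. standard normal and
`ξ = (ξ 1, …, ξ n)` independent of `X = (X 1, …, X n)`. -/
def GaussianErrors [MeasurableSpace Ω] (M : RegressionModel n p Ω) (P : Measure Ω) : Prop :=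
  ∃ ξ : Fin n → Ω → ℝ,
    (∀ i, ∀ᵐ ω ∂P, M.ε i ω = M.σ (M.X i ω) * ξ i ω) ∧
    iIndepFun ξ P ∧
    (∀ i, HasLaw (ξ i) (gaussianReal 0 1) P) ∧
    IndepFun (fun ω i => ξ i ω) (fun ω i => M.X i ω) P

/-- Gaussian design: the `X i` are i.i.d. `N(0, S)`, the smallest eigenvalue of the covariance
matrix `S` is at least `Cmin`, and its diagonal entries are less than `Cmax`. -/
def GaussianDesign [MeasurableSpace Ω] (M : RegressionModel n p Ω) (P : Measure Ω)
    (S : Matrix (Fin p) (Fin p) ℝ) (Cmin Cmax : ℝ) : Prop :=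
  iIndepFun M.X P ∧
  (∀ i, HasLaw (M.X i) (multivariateGaussian 0 S) P) ∧
  (∃ hS : S.PosSemidef, ∀ j, Cmin ≤ hS.isHermitian.eigenvalues j) ∧
  ∀ j, S j j < Cmax

/-- The null hypothesis of homoskedasticity: `σ` is constant, equal to `σ₀`. -/
def Homoskedastic (M : RegressionModel n p Ω) (σ₀ : ℝ) : Prop :=
  ∀ x, M.σ x = σ₀

end RegressionModel

/-- The Lasso objective `β ↦ ‖y - x β‖² / n + 2 lam ‖β‖₁`, where `x i` is the `i`-th row of the
design. -/
noncomputable def lassoObjective {n p : ℕ} (lam : ℝ) (x : Fin n → EuclideanSpace ℝ (Fin p))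
    (y : Fin n → ℝ) (β : EuclideanSpace ℝ (Fin p)) : ℝ :=
  1 / (n : ℝ) * ∑ i, (y i - inner ℝ (x i) β) ^ 2 + 2 * lam * ∑ j, |β j|

/-- `β` is a Lasso estimate, i.e. a global minimizer of the Lasso objective. -/
def IsLassoEstimate {n p : ℕ} (lam : ℝ) (x : Fin n → EuclideanSpace ℝ (Fin p))
    (y : Fin n → ℝ) (β : EuclideanSpace ℝ (Fin p)) : Prop :=
  ∀ b, lassoObjective lam x y β ≤ lassoObjective lam x y b

/-- The residuals of the coefficient vector `β`. -/
noncomputable def regResidual {n p : ℕ} (x : Fin n → EuclideanSpace ℝ (Fin p))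
    (y : Fin n → ℝ) (β : EuclideanSpace ℝ (Fin p)) (i : Fin n) : ℝ :=
  y i - inner ℝ (x i) β

/-- The sample mean of the squared residuals. -/
noncomputable def meanSq {n : ℕ} (e : Fin n → ℝ) : ℝ :=
  1 / (n : ℝ) * ∑ i, e i ^ 2

/-- The coefficient of variation statistic
`T = (1 / (n σ̂⁴)) ∑ i, (e i ^ 2 - σ̂²)²` of the residuals `e`, with `σ̂² = meanSq e`. -/
noncomputable def cvStatistic {n : ℕ} (e : Fin n → ℝ) : ℝ :=
  1 / ((n : ℝ) * meanSq e ^ 2) * ∑ i, (e i ^ 2 - meanSq e) ^ 2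

/-!
The law of `√n (T - 2)` is computed exactly in finite samples, and then a classical limit theorem
applies.

Write `Z = (X, ξ)` for the `n`-row sample of covariates and standardized errors. Under
homoskedasticity the rows are i.i.d. centred Gaussian, so left multiplication of `X` and `ξ` by an
orthogonal `n × n` matrix `O` does not change the joint law (`map_rowMul_pi`). The responses
`Y = X β₀ + σ₀ ξ` rotate along. The Lasso objective sees the sample only through
`‖Y - X β‖²`, so it is unchanged by the rotation, and the residual vector, which is unique although
the minimizer need not be (`IsLassoEstimate.regResidual_eq`), is rotated by `O`
(`lassoResidual_rowMul`). Hence the residual vector is rotation invariant in law. It is almost surely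
nonzero, since a Lasso with positive penalty never interpolates a nonzero response
(`lassoResidual_ne_zero`); so its direction is uniform on the unit sphere of `ℝⁿ`
(`eq_of_charFun_radial_of_norm_eq_one`). As `T` is scale invariant, it has the same law for the
residuals as for an i.i.d. standard normal sample (`map_cvStatistic_nullResidual`). Measurability of
the residuals, for a minimizer that may be chosen arbitrarily, comes from their continuity in the
data (`continuous_lassoResidual`).

For a standard normal sample with empirical moments `m₂`, `m₄` one has `T - 2 = (m₄ - 3 m₂²) / m₂²`,
and `m₄ - 3 m₂²` is the empirical mean of the Hermite polynomial `x⁴ - 6 x² + 3` minus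
`3 (m₂ - 1)²`. The central limit theorem for the former, whose variance is `4! = 24`, a Chebyshev
bound for the latter, the law of large numbers for `m₂` and Slutsky's theorem give the limit
(`tendstoInDistribution_cvStatistic_gaussian`).
-/

/-! ### Moments of the standard normal law -/

lemma integrable_pow_gaussianReal (k : ℕ) :
    Integrable (fun x : ℝ => x ^ k) (gaussianReal 0 1) := by
  have h := (memLp_id_gaussianReal' (μ := 0) (v := 1) (k : ENNReal) (by simp)).integrable_norm_pow'
  refine Integrable.congr' (f := fun x : ℝ => ‖x‖ ^ k) ?_ (by fun_prop) (ae_of_all _ fun x => by simp)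
  exact h

lemma hasDerivAt_gaussianPDFReal_zero_one (x : ℝ) :
    HasDerivAt (gaussianPDFReal 0 1) (-(x * gaussianPDFReal 0 1 x)) x := by
  have h : HasDerivAt (fun y : ℝ => -(y - 0) ^ 2 / (2 * ((1 : NNReal) : ℝ))) (-x) x := by
    have := (((hasDerivAt_id x).sub_const 0).pow 2).neg.div_const (2 * ((1 : NNReal) : ℝ))
    convert! this using 1
    simp only [id, NNReal.coe_one]
    push_cast
    ring
  have h2 := (h.exp).const_mul (√(2 * Real.pi * ((1 : NNReal) : ℝ)))⁻¹
  rw [gaussianPDFReal_def]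
  convert! h2 using 1
  ring

/-- The recursion for the moments of `N(0, 1)`, by Gaussian integration by parts. -/
lemma integral_pow_add_two_gaussianReal (k : ℕ) :
    ∫ x, x ^ (k + 2) ∂(gaussianReal 0 1) = (k + 1) * ∫ x, x ^ k ∂(gaussianReal 0 1) := by
  have hint (m : ℕ) : Integrable (fun x : ℝ => x ^ m * gaussianPDFReal 0 1 x) := by
    have h := integrable_pow_gaussianReal m
    rw [gaussianReal_of_var_ne_zero 0 one_ne_zero,
      integrable_withDensity_iff_integrable_smul₀' (by fun_prop)
        (ae_of_all _ fun x => by simp [gaussianPDF])] at h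
    refine h.congr (ae_of_all _ fun x => ?_)
    simp [mul_comm]
  have hparts := integral_mul_deriv_eq_deriv_mul_of_integrable
    (u := fun x : ℝ => x ^ (k + 1)) (u' := fun x => (k + 1 : ℝ) * x ^ k)
    (v := gaussianPDFReal 0 1) (v' := fun x => -(x * gaussianPDFReal 0 1 x))
    (fun x _ => by simpa using hasDerivAt_pow (k + 1) x)
    (fun x _ => hasDerivAt_gaussianPDFReal_zero_one x)
    ((hint (k + 2)).neg.congr (ae_of_all _ fun x => by simp; ring))
    (((hint k).const_mul (k + 1 : ℝ)).congr (ae_of_all _ fun x => by simp; ring))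
    (hint (k + 1))
  rw [integral_gaussianReal_eq_integral_smul one_ne_zero,
    integral_gaussianReal_eq_integral_smul one_ne_zero, ← integral_const_mul]
  have h1 : ∫ x : ℝ, x ^ (k + 1) * -(x * gaussianPDFReal 0 1 x)
      = -∫ x, gaussianPDFReal 0 1 x • x ^ (k + 2) := by
    rw [← integral_neg]
    exact integral_congr_ae (ae_of_all _ fun x => by simp; ring)
  rw [h1, neg_inj] at hparts
  rw [hparts]
  exact integral_congr_ae (ae_of_all _ fun x => by simp; ring)

lemma integral_sq_gaussianReal : ∫ x, x ^ 2 ∂(gaussianReal 0 1) = 1 := by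
  rw [integral_pow_add_two_gaussianReal 0]; simp

lemma integral_pow_four_gaussianReal : ∫ x, x ^ 4 ∂(gaussianReal 0 1) = 3 := by
  rw [integral_pow_add_two_gaussianReal 2, integral_sq_gaussianReal]; norm_num

lemma integral_pow_six_gaussianReal : ∫ x, x ^ 6 ∂(gaussianReal 0 1) = 15 := by
  rw [integral_pow_add_two_gaussianReal 4, integral_pow_four_gaussianReal]; norm_num

lemma integral_pow_eight_gaussianReal : ∫ x, x ^ 8 ∂(gaussianReal 0 1) = 105 := by
  rw [integral_pow_add_two_gaussianReal 6, integral_pow_six_gaussianReal]; norm_num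

/-- The fourth (probabilists') Hermite polynomial. -/
def hermiteFour (x : ℝ) : ℝ := x ^ 4 - 6 * x ^ 2 + 3

lemma continuous_hermiteFour : Continuous hermiteFour := by unfold hermiteFour; fun_prop

lemma integral_hermiteFour : ∫ x, hermiteFour x ∂(gaussianReal 0 1) = 0 := by
  have i2 := (integrable_pow_gaussianReal 2).const_mul 6
  have i4 := integrable_pow_gaussianReal 4
  have i42 : Integrable (fun x : ℝ => x ^ 4 - 6 * x ^ 2) (gaussianReal 0 1) := i4.sub i2
  unfold hermiteFour
  rw [integral_add i42 (integrable_const _), integral_sub i4 i2, integral_const_mul,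
    integral_sq_gaussianReal, integral_pow_four_gaussianReal]
  simp; norm_num

lemma integral_hermiteFour_sq : ∫ x, hermiteFour x ^ 2 ∂(gaussianReal 0 1) = 24 := by
  have i2 := (integrable_pow_gaussianReal 2).const_mul 36
  have i4 := (integrable_pow_gaussianReal 4).const_mul 42
  have i6 := (integrable_pow_gaussianReal 6).const_mul 12
  have i8 := integrable_pow_gaussianReal 8
  have i86 : Integrable (fun x : ℝ => x ^ 8 - 12 * x ^ 6) (gaussianReal 0 1) := i8.sub i6
  have i864 : Integrable (fun x : ℝ => x ^ 8 - 12 * x ^ 6 + 42 * x ^ 4) (gaussianReal 0 1) :=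
    i86.add i4
  have i8642 : Integrable (fun x : ℝ => x ^ 8 - 12 * x ^ 6 + 42 * x ^ 4 - 36 * x ^ 2)
      (gaussianReal 0 1) := i864.sub i2
  have h : ∀ x : ℝ, hermiteFour x ^ 2
      = x ^ 8 - 12 * x ^ 6 + 42 * x ^ 4 - 36 * x ^ 2 + 9 := fun x => by
    unfold hermiteFour; ring
  simp_rw [h]
  rw [integral_add i8642 (integrable_const _), integral_sub i864 i2, integral_add i86 i4,
    integral_sub i8 i6,
    integral_const_mul, integral_const_mul, integral_const_mul, integral_sq_gaussianReal,
    integral_pow_four_gaussianReal, integral_pow_six_gaussianReal, integral_pow_eight_gaussianReal]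
  simp; norm_num

lemma integrable_hermiteFour_sq :
    Integrable (fun x => hermiteFour x ^ 2) (gaussianReal 0 1) := by
  by_contra h
  -- a Bochner integral with a nonzero value is that of an integrable function
  have := integral_undef h
  rw [integral_hermiteFour_sq] at this
  norm_num at this

lemma memLp_hermiteFour : MemLp hermiteFour 2 (gaussianReal 0 1) :=
  (memLp_two_iff_integrable_sq continuous_hermiteFour.aestronglyMeasurable).2
    integrable_hermiteFour_sq

lemma memLp_sq_gaussianReal : MemLp (fun x : ℝ => x ^ 2) 2 (gaussianReal 0 1) :=
  (memLp_two_iff_integrable_sq (by fun_prop)).2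
    ((integrable_pow_gaussianReal 4).congr (ae_of_all _ fun x => by ring))

lemma variance_hermiteFour : Var[hermiteFour; gaussianReal 0 1] = 24 := by
  rw [variance_eq_sub memLp_hermiteFour]
  simp [integral_hermiteFour_sq, integral_hermiteFour]

lemma variance_sq_gaussianReal : Var[fun x : ℝ => x ^ 2; gaussianReal 0 1] = 2 := by
  rw [variance_eq_sub memLp_sq_gaussianReal]
  have : ∀ x : ℝ, (x ^ 2) ^ 2 = x ^ 4 := fun x => by ring
  simp [integral_sq_gaussianReal, this, integral_pow_four_gaussianReal]
  norm_num

/-! ### The statistic of a standard normal sample -/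

/-- The coefficient of variation statistic is `m₄ / m₂² - 1` with `m₂`, `m₄` the empirical second and
fourth moments; here `m₄` is expressed through the Hermite polynomial. -/
lemma sqrt_mul_cvStatistic_sub_two {n : ℕ} (e : Fin n → ℝ) (he : n ≠ 0 → meanSq e ≠ 0) :
    √(n : ℝ) * (cvStatistic e - 2)
      = ((√(n : ℝ))⁻¹ * ∑ i, hermiteFour (e i) - 3 * (√(n : ℝ) * (meanSq e - 1) ^ 2))
        * (meanSq e ^ 2)⁻¹ := by
  rcases Nat.eq_zero_or_pos n with rfl | hn
  · simp
  have hn0 : (0 : ℝ) < n := by exact_mod_cast hn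
  have hm := he hn.ne'
  have h2 : ∑ i, e i ^ 2 = n * meanSq e := by
    unfold meanSq; field_simp
  have hcv : ∑ i, (e i ^ 2 - meanSq e) ^ 2 = ∑ i, e i ^ 4 - n * meanSq e ^ 2 := by
    have : ∀ i, (e i ^ 2 - meanSq e) ^ 2
        = e i ^ 4 - 2 * meanSq e * e i ^ 2 + meanSq e ^ 2 := fun i => by ring
    simp_rw [this, Finset.sum_add_distrib, Finset.sum_sub_distrib, ← Finset.mul_sum, h2]
    simp; ring
  have hH : ∑ i, hermiteFour (e i) = ∑ i, e i ^ 4 - 6 * (n * meanSq e) + 3 * n := by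
    unfold hermiteFour
    simp_rw [Finset.sum_add_distrib, Finset.sum_sub_distrib, ← Finset.mul_sum, h2]
    simp; ring
  have hs : √(n : ℝ) ≠ 0 := (Real.sqrt_pos.2 hn0).ne'
  have hinv : (√(n : ℝ))⁻¹ = √(n : ℝ) / n := by
    rw [eq_div_iff hn0.ne']
    nth_rw 2 [← Real.mul_self_sqrt hn0.le]
    field_simp
  unfold cvStatistic
  rw [hcv, hH, hinv]
  field_simp
  ring

section IID

variable {Ω : Type*} [MeasurableSpace Ω] {P : Measure Ω}
  {g : ℕ → Ω → ℝ}

lemma identDistrib_comp_of_hasLaw {ν : Measure ℝ} (hg : ∀ i, HasLaw (g i) ν P) {f : ℝ → ℝ}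
    (hf : Measurable f) (i : ℕ) :
    IdentDistrib (fun ω => f (g i ω)) (fun ω => f (g 0 ω)) P P :=
  IdentDistrib.comp ⟨(hg i).aemeasurable, (hg 0).aemeasurable, by
    rw [(hg i).map_eq, (hg 0).map_eq]⟩ hf

/-- The mean of squares of an i.i.d. standard normal sequence tends to `1`. -/
lemma ae_tendsto_meanSq (hg : ∀ i, HasLaw (g i) (gaussianReal 0 1) P) (hind : iIndepFun g P) :
    ∀ᵐ ω ∂P, Tendsto (fun n : ℕ => meanSq (fun i : Fin n => g i ω)) atTop (𝓝 1) := by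
  have hint : Integrable (fun ω => g 0 ω ^ 2) P :=
    ((hg 0).map_eq ▸ integrable_pow_gaussianReal 2).comp_aemeasurable (hg 0).aemeasurable
  have h := strong_law_ae_real (fun i ω => g i ω ^ 2) hint
    (fun i j hij => (hind.indepFun hij).comp (φ := fun x : ℝ => x ^ 2) (ψ := fun x : ℝ => x ^ 2)
      (by fun_prop) (by fun_prop))
    (identDistrib_comp_of_hasLaw hg (f := fun x => x ^ 2) (by fun_prop))
  have hE : ∫ ω, g 0 ω ^ 2 ∂P = 1 := by
    rw [← integral_sq_gaussianReal]
    exact (hg 0).integral_comp (f := fun x => x ^ 2) (by fun_prop)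
  filter_upwards [h] with ω hω
  rw [hE] at hω
  refine hω.congr fun n => ?_
  rw [meanSq, Fin.sum_univ_eq_sum_range (fun i => g i ω ^ 2) n]
  ring

/-- By Chebyshev's inequality, `m₂ - 1 = o(n ^ (-1 / 4))` in probability. -/
lemma tendstoInMeasure_sqrt_mul_meanSq_sub_one_sq [IsProbabilityMeasure P]
    (hg : ∀ i, HasLaw (g i) (gaussianReal 0 1) P) (hind : iIndepFun g P) :
    TendstoInMeasure P
      (fun (n : ℕ) ω => √(n : ℝ) * (meanSq (fun i : Fin n => g i ω) - 1) ^ 2) atTop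
      (fun _ => 0) := by
  have hLp (i : ℕ) : MemLp (fun ω => g i ω ^ 2) 2 P :=
    ((hg i).map_eq ▸ memLp_sq_gaussianReal).comp_of_map (hg i).aemeasurable
  have hvar (i : ℕ) : Var[fun ω => g i ω ^ 2; P] = 2 := by
    rw [← variance_sq_gaussianReal, ← (hg i).map_eq,
      variance_map (by fun_prop) (hg i).aemeasurable]
    rfl
  have hE (i : ℕ) : ∫ ω, g i ω ^ 2 ∂P = 1 := by
    rw [← integral_sq_gaussianReal]
    exact (hg i).integral_comp (f := fun x => x ^ 2) (by fun_prop)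
  have hsumLp (n : ℕ) : MemLp (∑ i ∈ Finset.range n, fun ω => g i ω ^ 2) 2 P :=
    memLp_finsetSum' _ fun i _ => hLp i
  have hsumvar (n : ℕ) : Var[∑ i ∈ Finset.range n, fun ω => g i ω ^ 2; P] = 2 * n := by
    rw [IndepFun.variance_sum (fun i _ => hLp i)]
    · simp [hvar, mul_comm]
    · intro i _ j _ hij
      exact (hind.indepFun hij).comp (φ := fun x : ℝ => x ^ 2) (ψ := fun x : ℝ => x ^ 2)
        (by fun_prop) (by fun_prop)
  have hsumE (n : ℕ) : ∫ ω, (∑ i ∈ Finset.range n, fun ω => g i ω ^ 2) ω ∂P = n := by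
    simp only [Finset.sum_apply]
    rw [integral_finsetSum _ fun i _ => (hLp i).integrable (by norm_num)]
    simp [hE]
  rw [tendstoInMeasure_iff_norm]
  intro ε hε
  have hlim : Tendsto (fun n : ℕ => ENNReal.ofReal (2 / ε * (√(n : ℝ))⁻¹)) atTop (𝓝 0) := by
    rw [← ENNReal.ofReal_zero]
    refine ENNReal.tendsto_ofReal ?_
    have : Tendsto (fun n : ℕ => (√(n : ℝ))⁻¹) atTop (𝓝 0) :=
      (Real.tendsto_sqrt_atTop.comp tendsto_natCast_atTop_atTop).inv_tendsto_atTop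
    simpa using this.const_mul (2 / ε)
  refine tendsto_of_tendsto_of_tendsto_of_le_of_le' tendsto_const_nhds hlim
    (Eventually.of_forall fun _ => bot_le) ?_
  filter_upwards [eventually_gt_atTop 0] with n hn
  have hn0 : (0 : ℝ) < n := by exact_mod_cast hn
  have hs : 0 < √(n : ℝ) := Real.sqrt_pos.2 hn0
  -- the deviation of the sum of squares that corresponds to the deviation `ε`
  set c : ℝ := n * √(ε / √(n : ℝ)) with hc
  have hc0 : 0 < c := by positivity
  have hcsq : c ^ 2 = n ^ 2 * (ε / √(n : ℝ)) := by
    rw [hc, mul_pow, Real.sq_sqrt (by positivity)]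
  have hcheb := meas_ge_le_variance_div_sq (hsumLp n) hc0
  rw [hsumvar, hsumE] at hcheb
  refine (measure_mono ?_).trans (hcheb.trans (le_of_eq ?_))
  · intro ω hω
    simp only [Set.mem_ofPred_eq, sub_zero, Finset.sum_apply] at hω ⊢
    rw [meanSq, Fin.sum_univ_eq_sum_range (fun i => g i ω ^ 2) n, Real.norm_of_nonneg
      (by positivity)] at hω
    refine abs_le_of_sq_le_sq' ?_ (abs_nonneg _) |>.2
    rw [sq_abs, hcsq]
    calc (n : ℝ) ^ 2 * (ε / √(n : ℝ))
        ≤ n ^ 2 * ((√(n : ℝ) * (1 / n * ∑ i ∈ Finset.range n, g i ω ^ 2 - 1) ^ 2) / √(n : ℝ)) := by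
          gcongr
      _ = _ := by field_simp
  · congr 1
    rw [hcsq]
    nth_rw 2 [← Real.sq_sqrt hn0.le]
    nth_rw 1 [← Real.sq_sqrt hn0.le]
    field_simp

lemma meanSq_eq_zero_iff {n : ℕ} {e : Fin n → ℝ} (hn : n ≠ 0) : meanSq e = 0 ↔ e = 0 := by
  have : (n : ℝ) ≠ 0 := by exact_mod_cast hn
  rw [meanSq, mul_eq_zero, or_iff_right (by simpa using hn),
    Finset.sum_eq_zero_iff_of_nonneg fun i _ => sq_nonneg _]
  simp [funext_iff]

lemma ae_meanSq_ne_zero (hg : ∀ i, HasLaw (g i) (gaussianReal 0 1) P) (n : ℕ) :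
    ∀ᵐ ω ∂P, n ≠ 0 → meanSq (fun i : Fin n => g i ω) ≠ 0 := by
  have h0 : ∀ᵐ ω ∂P, g 0 ω ≠ 0 := by
    refine ae_of_ae_map (hg 0).aemeasurable (p := fun x => x ≠ 0) ?_
    rw [(hg 0).map_eq]
    have := nullSingletonClass_gaussianReal (μ := 0) (v := 1) one_ne_zero
    exact Measure.ae_ne _ 0
  filter_upwards [h0] with ω hω hn h
  rw [meanSq_eq_zero_iff hn] at h
  exact hω (congrFun h ⟨0, Nat.pos_of_ne_zero hn⟩)

lemma measurable_meanSq {n : ℕ} : Measurable (meanSq : (Fin n → ℝ) → ℝ) := by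
  unfold meanSq; fun_prop

lemma measurable_cvStatistic {n : ℕ} : Measurable (cvStatistic : (Fin n → ℝ) → ℝ) := by
  unfold cvStatistic
  have := measurable_meanSq (n := n)
  fun_prop

/-- The coefficient of variation statistic of an i.i.d. standard normal sample is asymptotically
normal: up to negligible terms, `√n (T - 2)` is the normalized sum of the fourth Hermite polynomial,
which has variance `4! = 24`. -/
theorem tendstoInDistribution_cvStatistic_gaussian [IsProbabilityMeasure P]
    (hg : ∀ i, HasLaw (g i) (gaussianReal 0 1) P) (hind : iIndepFun g P) :
    TendstoInDistribution
      (fun (n : ℕ) ω => √(n : ℝ) * (cvStatistic (fun i : Fin n => g i ω) - 2))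
      atTop (id : ℝ → ℝ) (fun _ => P) (gaussianReal 0 24) := by
  have hgm (i : ℕ) : AEMeasurable (g i) P := (hg i).aemeasurable
  have hmeas (n : ℕ) : AEMeasurable (fun ω => meanSq (fun i : Fin n => g i ω)) P :=
    measurable_meanSq.comp_aemeasurable (aemeasurable_pi_lambda _ fun i => hgm i)
  -- `√n (T - 2) = (A - 3 B) C` with `A` asymptotically `N(0, 24)`, `B → 0` and `C → 1`
  have hvar : Var[fun ω => hermiteFour (g 0 ω); P] = 24 := by
    rw [← variance_hermiteFour, ← (hg 0).map_eq,
      variance_map continuous_hermiteFour.aemeasurable (hgm 0)]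
    rfl
  have hE : ∫ ω, hermiteFour (g 0 ω) ∂P = 0 := by
    rw [← integral_hermiteFour]
    exact (hg 0).integral_comp continuous_hermiteFour.aestronglyMeasurable
  have hA := tendstoInDistribution_inv_sqrt_mul_sum_sub (P := P)
    (X := fun i ω => hermiteFour (g i ω)) (Y := (id : ℝ → ℝ)) (P' := gaussianReal 0 24)
    (by
      rw [hvar]
      convert HasLaw.id using 2
      ext; simp)
    (((hg 0).map_eq ▸ memLp_hermiteFour).comp_of_map (hgm 0))
    (hind.comp (fun _ => hermiteFour) fun _ => continuous_hermiteFour.measurable)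
    (identDistrib_comp_of_hasLaw hg continuous_hermiteFour.measurable)
  have hB := tendstoInMeasure_sqrt_mul_meanSq_sub_one_sq hg hind
  have hC : TendstoInMeasure P (fun (n : ℕ) ω => (meanSq (fun i : Fin n => g i ω) ^ 2)⁻¹) atTop
      (fun _ => 1) := by
    refine tendstoInMeasure_of_tendsto_ae
      (fun n => ((hmeas n).pow_const 2).inv.aestronglyMeasurable) ?_
    filter_upwards [ae_tendsto_meanSq hg hind] with ω hω
    simpa using (hω.pow 2).inv₀ (by norm_num)
  have hAB := hA.continuous_comp_prodMk_of_tendstoInMeasure_const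
    (g := fun z : ℝ × ℝ => z.1 - 3 * z.2) (by fun_prop) hB
    fun n => (((hmeas n).sub_const 1).pow_const 2).const_mul _
  have hABC := hAB.continuous_comp_prodMk_of_tendstoInMeasure_const
    (g := fun z : ℝ × ℝ => z.1 * z.2) (by fun_prop) hC fun n => ((hmeas n).pow_const 2).inv
  refine hABC.congr (fun n => ?_) (ae_of_all _ fun x => by simp)
  filter_upwards [ae_meanSq_ne_zero hg n] with ω hω
  rw [sqrt_mul_cvStatistic_sub_two _ hω, hE,
    Fin.sum_univ_eq_sum_range (fun i => hermiteFour (g i ω)) n]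
  simp

end IID

/-! ### Lasso residuals -/

section Lasso

variable {n p : ℕ} {lam : ℝ} {x : Fin n → EuclideanSpace ℝ (Fin p)} {y : Fin n → ℝ}

lemma tendsto_lassoObjective (lam : ℝ) {ι : Type*} {l : Filter ι}
    {u : ι → (Fin n → EuclideanSpace ℝ (Fin p)) × (Fin n → ℝ)}
    {z : (Fin n → EuclideanSpace ℝ (Fin p)) × (Fin n → ℝ)} {β : ι → EuclideanSpace ℝ (Fin p)}
    {b : EuclideanSpace ℝ (Fin p)} (hu : Tendsto u l (𝓝 z)) (hβ : Tendsto β l (𝓝 b)) :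
    Tendsto (fun k => lassoObjective lam (u k).1 (u k).2 (β k)) l
      (𝓝 (lassoObjective lam z.1 z.2 b)) := by
  have h : Continuous fun w : ((Fin n → EuclideanSpace ℝ (Fin p)) × (Fin n → ℝ)) ×
      EuclideanSpace ℝ (Fin p) => lassoObjective lam w.1.1 w.1.2 w.2 := by
    unfold lassoObjective; fun_prop
  have hpair : Tendsto (fun k => (u k, β k)) l (𝓝 (z, b)) := hu.prodMk_nhds hβ
  have hcomp := Tendsto.comp (h.tendsto (z, b)) hpair
  exact hcomp

lemma tendsto_regResidual {ι : Type*} {l : Filter ι}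
    {u : ι → (Fin n → EuclideanSpace ℝ (Fin p)) × (Fin n → ℝ)}
    {z : (Fin n → EuclideanSpace ℝ (Fin p)) × (Fin n → ℝ)} {β : ι → EuclideanSpace ℝ (Fin p)}
    {b : EuclideanSpace ℝ (Fin p)} (hu : Tendsto u l (𝓝 z)) (hβ : Tendsto β l (𝓝 b)) :
    Tendsto (fun k => regResidual (u k).1 (u k).2 (β k)) l (𝓝 (regResidual z.1 z.2 b)) := by
  have h : Continuous fun w : ((Fin n → EuclideanSpace ℝ (Fin p)) × (Fin n → ℝ)) ×
      EuclideanSpace ℝ (Fin p) => regResidual w.1.1 w.1.2 w.2 := by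
    unfold regResidual; fun_prop
  have hpair : Tendsto (fun k => (u k, β k)) l (𝓝 (z, b)) := hu.prodMk_nhds hβ
  have hcomp := Tendsto.comp (h.tendsto (z, b)) hpair
  exact hcomp

lemma norm_le_sum_abs (β : EuclideanSpace ℝ (Fin p)) : ‖β‖ ≤ ∑ j, |β j| := by
  rw [EuclideanSpace.norm_eq]
  refine Real.sqrt_le_iff.2 ⟨by positivity, ?_⟩
  simpa using Finset.sum_sq_le_sq_sum_of_nonneg (s := Finset.univ) (f := fun j => |β j|)
    fun j _ => abs_nonneg _

lemma two_mul_norm_le_lassoObjective (hlam : 0 < lam) (β : EuclideanSpace ℝ (Fin p)) :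
    2 * lam * ‖β‖ ≤ lassoObjective lam x y β := by
  unfold lassoObjective
  have h : 0 ≤ 1 / (n : ℝ) * ∑ i, (y i - inner ℝ (x i) β) ^ 2 := by positivity
  have := mul_le_mul_of_nonneg_left (norm_le_sum_abs β) (by positivity : 0 ≤ 2 * lam)
  linarith

lemma exists_isLassoEstimate (hlam : 0 < lam) (x : Fin n → EuclideanSpace ℝ (Fin p))
    (y : Fin n → ℝ) : ∃ β, IsLassoEstimate lam x y β := by
  refine Continuous.exists_forall_le (f := lassoObjective lam x y)
    (by unfold lassoObjective; fun_prop) ?_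
  refine tendsto_atTop_mono (fun β => two_mul_norm_le_lassoObjective hlam β) ?_
  exact tendsto_norm_cocompact_atTop.const_mul_atTop (by positivity)

/-- The Lasso coefficients need not be unique, but the Lasso residuals are, by strict convexity of
the squared loss in the fitted values. -/
lemma IsLassoEstimate.regResidual_eq (hlam : 0 < lam) {β β' : EuclideanSpace ℝ (Fin p)}
    (h : IsLassoEstimate lam x y β) (h' : IsLassoEstimate lam x y β') :
    regResidual x y β = regResidual x y β' := by
  rcases Nat.eq_zero_or_pos n with rfl | hn
  · exact Subsingleton.elim _ _
  have hn0 : (0 : ℝ) < n := by exact_mod_cast hn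
  set b : EuclideanSpace ℝ (Fin p) := (1 / 2 : ℝ) • (β + β') with hb
  have hsq : ∑ i, (y i - inner ℝ (x i) b) ^ 2
      = 1 / 2 * ∑ i, (y i - inner ℝ (x i) β) ^ 2 + 1 / 2 * ∑ i, (y i - inner ℝ (x i) β') ^ 2
        - 1 / 4 * ∑ i, (regResidual x y β i - regResidual x y β' i) ^ 2 := by
    simp_rw [Finset.mul_sum, ← Finset.sum_add_distrib, ← Finset.sum_sub_distrib]
    refine Finset.sum_congr rfl fun i _ => ?_
    rw [hb, inner_smul_right, inner_add_right]
    unfold regResidual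
    ring
  have habs : ∑ j, |b j| ≤ 1 / 2 * ∑ j, |β j| + 1 / 2 * ∑ j, |β' j| := by
    simp_rw [Finset.mul_sum, ← Finset.sum_add_distrib]
    refine Finset.sum_le_sum fun j _ => ?_
    have := abs_add_le (β j) (β' j)
    simp only [hb, PiLp.smul_apply, PiLp.add_apply, smul_eq_mul, abs_mul]
    rw [abs_of_pos (by norm_num : (0 : ℝ) < 1 / 2)]
    linarith
  have h1 := h b
  have h2 := h' b
  unfold lassoObjective at h1 h2
  rw [hsq] at h1 h2
  have h3 := mul_le_mul_of_nonneg_left habs (by positivity : 0 ≤ 2 * lam)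
  have h4 : 1 / (n : ℝ) * (1 / 4 * ∑ i, (regResidual x y β i - regResidual x y β' i) ^ 2) ≤ 0 := by
    linarith
  have h5 : ∑ i, (regResidual x y β i - regResidual x y β' i) ^ 2 ≤ 0 := by
    by_contra! hpos
    have : 0 < 1 / (n : ℝ) * (1 / 4 * ∑ i, (regResidual x y β i - regResidual x y β' i) ^ 2) := by
      positivity
    linarith
  have h6 := (Finset.sum_eq_zero_iff_of_nonneg fun i _ => sq_nonneg _).1
    (le_antisymm h5 (Finset.sum_nonneg fun i _ => sq_nonneg _))
  ext i
  simpa [sub_eq_zero] using h6 i (Finset.mem_univ i)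

/-- The residuals of the Lasso with design `z.1` and response `z.2`; they do not depend on the
choice of the minimizer. -/
noncomputable def lassoResidual (hlam : 0 < lam)
    (z : (Fin n → EuclideanSpace ℝ (Fin p)) × (Fin n → ℝ)) : Fin n → ℝ :=
  regResidual z.1 z.2 (exists_isLassoEstimate hlam z.1 z.2).choose

lemma IsLassoEstimate.regResidual_eq_lassoResidual (hlam : 0 < lam)
    {β : EuclideanSpace ℝ (Fin p)} (h : IsLassoEstimate lam x y β) :
    regResidual x y β = lassoResidual hlam (x, y) :=
  h.regResidual_eq hlam (exists_isLassoEstimate hlam x y).choose_spec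

/-- Minimizers for a convergent sequence of data are bounded, and each of their limit points is a
minimizer for the limit; so uniqueness of the residuals makes them continuous in the data. -/
lemma continuous_lassoResidual (hlam : 0 < lam) :
    Continuous (lassoResidual (n := n) (p := p) hlam) := by
  refine SeqContinuous.continuous fun u z hu => ?_
  choose β hβ using fun k => exists_isLassoEstimate hlam (u k).1 (u k).2
  refine tendsto_of_subseq_tendsto fun ns hns => ?_
  have hun : Tendsto (fun k => u (ns k)) atTop (𝓝 z) := hu.comp hns
  have hcomp (b : EuclideanSpace ℝ (Fin p)) :
      Tendsto (fun k => lassoObjective lam (u (ns k)).1 (u (ns k)).2 b) atTop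
        (𝓝 (lassoObjective lam z.1 z.2 b)) :=
    tendsto_lassoObjective lam hun tendsto_const_nhds
  obtain ⟨C, hC⟩ := (hcomp 0).bddAbove_range
  have hbound (k : ℕ) : β (ns k) ∈ Metric.closedBall 0 (C / (2 * lam)) := by
    have h1 := two_mul_norm_le_lassoObjective (x := (u (ns k)).1) (y := (u (ns k)).2) hlam (β (ns k))
    have h2 := hβ (ns k) 0
    have h3 := hC (Set.mem_range_self k)
    rw [mem_closedBall_zero_iff, le_div_iff₀' (by positivity)]
    linarith
  obtain ⟨b, -, φ, hφ, hb⟩ := tendsto_subseq_of_bounded Metric.isBounded_closedBall hbound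
  have huφ : Tendsto (fun k => u (ns (φ k))) atTop (𝓝 z) := hun.comp hφ.tendsto_atTop
  have hbφ : Tendsto (fun k => β (ns (φ k))) atTop (𝓝 b) := hb
  have hmin : IsLassoEstimate lam z.1 z.2 b := fun c =>
    le_of_tendsto_of_tendsto' (tendsto_lassoObjective lam huφ hbφ)
      (tendsto_lassoObjective lam huφ tendsto_const_nhds) fun k => hβ (ns (φ k)) c
  have hz : regResidual z.1 z.2 b = lassoResidual hlam z := hmin.regResidual_eq_lassoResidual hlam
  refine ⟨φ, ?_⟩
  rw [← hz]
  refine (tendsto_regResidual huφ hbφ).congr fun k => ?_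
  exact (hβ (ns (φ k))).regResidual_eq_lassoResidual hlam

/-- Shrinking an interpolating coefficient vector decreases the penalty to first order and increases
the squared loss only to second order; so the Lasso with a positive penalty never interpolates a
nonzero response. -/
lemma lassoResidual_ne_zero (hlam : 0 < lam) (hy : y ≠ 0) : lassoResidual hlam (x, y) ≠ 0 := by
  intro h0
  obtain ⟨β, hβ⟩ := exists_isLassoEstimate hlam x y
  rw [← hβ.regResidual_eq_lassoResidual hlam] at h0
  have hfit (i : Fin n) : inner ℝ (x i) β = y i := by
    have := congrFun h0 i
    simp only [regResidual, Pi.zero_apply] at this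
    linarith
  set A : ℝ := 1 / (n : ℝ) * ∑ i, y i ^ 2 with hA
  set B : ℝ := ∑ j, |β j| with hB
  have hB0 : 0 ≤ B := by positivity
  have hA0 : 0 ≤ A := by positivity
  have key (t : ℝ) (ht0 : 0 < t) (ht1 : t ≤ 1) : 2 * lam * B ≤ t * A := by
    have h := hβ ((1 - t) • β)
    unfold lassoObjective at h
    have e1 : ∀ i, y i - (1 - t) * y i = t * y i := fun i => by ring
    simp only [hfit, sub_self, inner_smul_right, PiLp.smul_apply, smul_eq_mul, abs_mul, e1,
      abs_of_nonneg (sub_nonneg.2 ht1), ← Finset.mul_sum, mul_pow, ← hB] at h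
    simp only [ne_eq, OfNat.ofNat_ne_zero, not_false_eq_true, zero_pow, Finset.sum_const_zero,
      mul_zero, zero_add] at h
    have e2 : 1 / (n : ℝ) * (t ^ 2 * ∑ i, y i ^ 2) = t * (t * A) := by rw [hA]; ring
    rw [e2] at h
    nlinarith
  have hBz : B = 0 := by
    by_contra hne
    have hBp : 0 < B := lt_of_le_of_ne hB0 (Ne.symm hne)
    have hlB : 0 < lam * B := by positivity
    have h := key (min 1 (lam * B / (A + 1))) (by positivity) (min_le_left _ _)
    have h2 : min 1 (lam * B / (A + 1)) * A ≤ lam * B / (A + 1) * (A + 1) := by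
      gcongr
      · exact min_le_right _ _
      · linarith
    rw [div_mul_cancel₀ _ (by positivity)] at h2
    linarith
  have hβ0 : β = 0 := by
    ext j
    have := (Finset.sum_eq_zero_iff_of_nonneg fun j _ => abs_nonneg _).1 hBz j (Finset.mem_univ j)
    simpa using this
  refine hy (funext fun i => ?_)
  rw [← hfit i, hβ0]; simp

/-- The rows `∑ k, O i k • x k` of the product of `O` and the matrix with rows `x k`. -/
def rowMul {V : Type*} [AddCommMonoid V] [Module ℝ V] (O : Matrix (Fin n) (Fin n) ℝ)
    (x : Fin n → V) (i : Fin n) : V :=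
  ∑ k, O i k • x k

lemma rowMul_eq_mulVec (O : Matrix (Fin n) (Fin n) ℝ) (v : Fin n → ℝ) :
    rowMul O v = O.mulVec v := by
  ext i; simp [rowMul, Matrix.mulVec, dotProduct]

lemma inner_rowMul (O : Matrix (Fin n) (Fin n) ℝ) (x : Fin n → EuclideanSpace ℝ (Fin p))
    (β : EuclideanSpace ℝ (Fin p)) (i : Fin n) :
    inner ℝ (rowMul O x i) β = O.mulVec (fun k => inner ℝ (x k) β) i := by
  simp [rowMul, sum_inner, inner_smul_left, Matrix.mulVec, dotProduct]

lemma regResidual_rowMul (O : Matrix (Fin n) (Fin n) ℝ) (x : Fin n → EuclideanSpace ℝ (Fin p))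
    (y : Fin n → ℝ) (β : EuclideanSpace ℝ (Fin p)) :
    regResidual (rowMul O x) (O.mulVec y) β = O.mulVec (regResidual x y β) := by
  ext i
  simp only [regResidual, inner_rowMul]
  rw [← Pi.sub_apply, ← Matrix.mulVec_sub]
  rfl

lemma sum_sq_mulVec {O : Matrix (Fin n) (Fin n) ℝ} (hO : O.transpose * O = 1) (v : Fin n → ℝ) :
    ∑ i, O.mulVec v i ^ 2 = ∑ i, v i ^ 2 := by
  have h (w : Fin n → ℝ) : ∑ i, w i ^ 2 = dotProduct w w := by simp [dotProduct, sq]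
  rw [h, h, Matrix.dotProduct_mulVec, Matrix.vecMul_mulVec, hO]
  simp

lemma lassoObjective_rowMul {O : Matrix (Fin n) (Fin n) ℝ} (hO : O.transpose * O = 1)
    (x : Fin n → EuclideanSpace ℝ (Fin p)) (y : Fin n → ℝ) (β : EuclideanSpace ℝ (Fin p)) :
    lassoObjective lam (rowMul O x) (O.mulVec y) β = lassoObjective lam x y β := by
  have h := sum_sq_mulVec hO (regResidual x y β)
  rw [← regResidual_rowMul] at h
  unfold lassoObjective
  unfold regResidual at h
  rw [h]

/-- Rotating the sample, i.e. the design and the response simultaneously, rotates the residuals. -/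
lemma lassoResidual_rowMul (hlam : 0 < lam) {O : Matrix (Fin n) (Fin n) ℝ}
    (hO : O.transpose * O = 1) (x : Fin n → EuclideanSpace ℝ (Fin p)) (y : Fin n → ℝ) :
    lassoResidual hlam (rowMul O x, O.mulVec y) = O.mulVec (lassoResidual hlam (x, y)) := by
  obtain ⟨β, hβ⟩ := exists_isLassoEstimate hlam x y
  have hβ' : IsLassoEstimate lam (rowMul O x) (O.mulVec y) β := fun b => by
    simpa only [lassoObjective_rowMul hO] using hβ b
  rw [← hβ.regResidual_eq_lassoResidual hlam, ← hβ'.regResidual_eq_lassoResidual hlam,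
    regResidual_rowMul]

end Lasso

/-! ### Rotation invariance -/

section Rotation

/-- Orthogonal matrices act transitively on each sphere, already through reflections. -/
lemma exists_orthogonal_mulVec_eq {n : ℕ} {s t : EuclideanSpace ℝ (Fin n)} (h : ‖s‖ = ‖t‖) :
    ∃ O : Matrix (Fin n) (Fin n) ℝ, O.transpose * O = 1 ∧ O.mulVec s = t := by
  set e : EuclideanSpace ℝ (Fin n) ≃ₗᵢ[ℝ] EuclideanSpace ℝ (Fin n) :=
    (ℝ ∙ (s - t))ᗮ.reflection with he
  set O : Matrix (Fin n) (Fin n) ℝ := (Matrix.toEuclideanLin (𝕜 := ℝ)).symm e.toLinearMap with hO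
  have hOe (v : EuclideanSpace ℝ (Fin n)) : O.mulVec v = e v := by
    have : Matrix.toEuclideanLin O v = e v := by rw [hO, LinearEquiv.apply_symm_apply]; rfl
    rw [← this]; rfl
  have hOO : O * O = 1 := by
    refine Matrix.toEuclideanLin.injective (LinearMap.ext fun v => ?_)
    ext i
    have h1 : (O * O).mulVec v = v := by
      rw [← Matrix.mulVec_mulVec, hOe, hOe]
      simp [he]
    simpa [Matrix.toEuclideanLin] using congrFun h1 i
  have hOt : O.transpose * O = 1 := by
    ext i j
    have hcol (k : Fin n) : O.col k = (e (EuclideanSpace.single k 1) : Fin n → ℝ) := by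
      rw [← hOe]; simp
    have h2 : inner ℝ (e (EuclideanSpace.single j 1)) (e (EuclideanSpace.single i 1))
        = (1 : Matrix (Fin n) (Fin n) ℝ) i j := by
      rw [e.inner_map_map]
      simp [Matrix.one_apply, EuclideanSpace.inner_single_left, eq_comm]
    rw [← h2, Matrix.mul_apply, PiLp.inner_apply]
    refine Finset.sum_congr rfl fun k _ => ?_
    rw [← congrFun (hcol i) k, ← congrFun (hcol j) k]
    simp [Matrix.col]
  refine ⟨O, hOt, ?_⟩
  rw [hOe, he, Submodule.reflection_sub h]

variable {E : Type*} [NormedAddCommGroup E] [InnerProductSpace ℝ E] [MeasurableSpace E]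
  [BorelSpace E] [SecondCountableTopology E] [CompleteSpace E]

/-- There is only one rotation-invariant probability measure on the unit sphere. Rotation invariance
is expressed by the characteristic function being radial. Averaging the characteristic function of
`μ` over `ν` and exchanging the integrals turns it into that of `ν`. -/
theorem eq_of_charFun_radial_of_norm_eq_one {μ ν : Measure E} [IsProbabilityMeasure μ]
    [IsProbabilityMeasure ν] (hμ : ∀ s t : E, ‖s‖ = ‖t‖ → charFun μ s = charFun μ t)
    (hν : ∀ s t : E, ‖s‖ = ‖t‖ → charFun ν s = charFun ν t)
    (hμ1 : ∀ᵐ x ∂μ, ‖x‖ = 1) (hν1 : ∀ᵐ x ∂ν, ‖x‖ = 1) : μ = ν := by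
  refine Measure.ext_of_charFun (funext fun t => ?_)
  have h1 : charFun μ t = ∫ y, charFun μ (‖t‖ • y) ∂ν := by
    have : ∀ᵐ y ∂ν, charFun μ (‖t‖ • y) = charFun μ t := by
      filter_upwards [hν1] with y hy
      exact hμ _ _ (by rw [norm_smul, hy]; simp)
    rw [integral_congr_ae this]; simp
  have h2 : charFun ν t = ∫ x, charFun ν (‖t‖ • x) ∂μ := by
    have : ∀ᵐ x ∂μ, charFun ν (‖t‖ • x) = charFun ν t := by
      filter_upwards [hμ1] with x hx
      exact hν _ _ (by rw [norm_smul, hx]; simp)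
    rw [integral_congr_ae this]; simp
  rw [h1, h2]
  simp_rw [charFun_apply]
  rw [integral_integral_swap]
  · refine integral_congr_ae (ae_of_all _ fun x => integral_congr_ae (ae_of_all _ fun y => ?_))
    simp only [inner_smul_right, real_inner_comm]
  · refine Integrable.of_bound (C := 1) ?_ (ae_of_all _ fun z => ?_)
    · refine Continuous.aestronglyMeasurable ?_
      simp only [Function.uncurry_def]
      fun_prop
    · simp only [Function.uncurry_def, Complex.norm_exp_ofReal_mul_I, le_refl]

end Rotation

section GaussianSample

variable {E : Type*} [NormedAddCommGroup E] [NormedSpace ℝ E] [MeasurableSpace E]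
  [BorelSpace E] [SecondCountableTopology E]

lemma measurable_rowMul {n : ℕ} (O : Matrix (Fin n) (Fin n) ℝ) :
    Measurable (rowMul O : (Fin n → E) → (Fin n → E)) := by
  unfold rowMul
  fun_prop

/-- The sum of a quadratic form over a family of vectors is invariant under orthogonal recombinations
of the family. -/
lemma sum_bilin_sum_smul {F : Type*} [NormedAddCommGroup F] [NormedSpace ℝ F] {n : ℕ}
    (B : F →L[ℝ] F →L[ℝ] ℝ) {O : Matrix (Fin n) (Fin n) ℝ} (hO : O * O.transpose = 1)
    (a : Fin n → F) :
    ∑ k, B (∑ i, O i k • a i) (∑ i, O i k • a i) = ∑ i, B (a i) (a i) := by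
  have hOO (i j : Fin n) : ∑ k, O i k * O j k = (1 : Matrix (Fin n) (Fin n) ℝ) i j := by
    rw [← hO]; simp [Matrix.mul_apply]
  calc ∑ k, B (∑ i, O i k • a i) (∑ i, O i k • a i)
      = ∑ k, ∑ j, ∑ i, (O i k * O j k) * B (a i) (a j) := by
        refine Finset.sum_congr rfl fun k _ => ?_
        rw [map_sum]
        refine Finset.sum_congr rfl fun j _ => ?_
        rw [map_smul, map_sum, sum_apply, smul_eq_mul, Finset.mul_sum]
        refine Finset.sum_congr rfl fun i _ => ?_
        rw [map_smul, smul_apply, smul_eq_mul]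
        ring
    _ = ∑ j, ∑ i, (∑ k, O i k * O j k) * B (a i) (a j) := by
        rw [Finset.sum_comm]
        refine Finset.sum_congr rfl fun i _ => ?_
        rw [Finset.sum_comm]
        simp_rw [Finset.sum_mul]
    _ = ∑ i, B (a i) (a i) := by
        simp_rw [hOO, Matrix.one_apply]
        simp

/-- The joint law of an i.i.d. sample from a centred Gaussian measure is invariant under orthogonal
recombinations of the sample. -/
lemma map_rowMul_pi [CompleteSpace E] {n : ℕ} {μ : Measure E} [IsGaussian μ] (hμ : ∫ x, x ∂μ = 0)
    {O : Matrix (Fin n) (Fin n) ℝ} (hO : O * O.transpose = 1) :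
    (Measure.pi fun _ : Fin n => μ).map (rowMul O) = Measure.pi fun _ => μ := by
  have hmap := (measurable_rowMul (E := E) O)
  have := Measure.isProbabilityMeasure_map (μ := Measure.pi fun _ : Fin n => μ) hmap.aemeasurable
  let R : (Fin n → E) →L[ℝ] (Fin n → E) :=
    ContinuousLinearMap.pi fun i => ∑ k, O i k • ContinuousLinearMap.proj k
  have hR : (rowMul O : (Fin n → E) → (Fin n → E)) = R := by
    ext x i; simp [R, rowMul]
  refine Measure.ext_of_charFunDual (funext fun L => ?_)
  have hchar (M : StrongDual ℝ E) :
      charFunDual μ M = Complex.exp (-(covarianceBilinDual μ M M / 2 : ℝ)) := by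
    rw [IsGaussian.charFunDual_eq']
    simp [hμ]
  have hcomp (k : Fin n) : (L.comp R).comp (.single ℝ (fun _ => E) k)
      = ∑ i, O i k • L.comp (.single ℝ (fun _ => E) i) := by
    ext v
    have : R (Pi.single k v) = ∑ i, O i k • (Pi.single i v : Fin n → E) := by
      ext j
      simp [R, Finset.sum_apply, Pi.single_apply]
    simp [this]
  rw [hR, charFunDual_map, charFunDual_pi, charFunDual_pi]
  simp_rw [hchar, ← Complex.exp_sum, hcomp]
  congr 1
  rw [Finset.sum_neg_distrib, Finset.sum_neg_distrib, ← Complex.ofReal_sum, ← Complex.ofReal_sum,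
    ← Finset.sum_div, ← Finset.sum_div, sum_bilin_sum_smul _ hO]

end GaussianSample

/-! ### The law of a scale-invariant statistic of a rotation-invariant vector -/

section Direction

variable {n : ℕ}

/-- The direction `r / ‖r‖` of a vector, in the Euclidean norm; it is `0` for `r = 0`. -/
noncomputable def direction (r : Fin n → ℝ) : EuclideanSpace ℝ (Fin n) :=
  ‖WithLp.toLp 2 r‖⁻¹ • WithLp.toLp 2 r

lemma measurable_direction : Measurable (direction (n := n)) := by
  unfold direction
  fun_prop

lemma norm_direction {r : Fin n → ℝ} (hr : r ≠ 0) : ‖direction r‖ = 1 := by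
  have : WithLp.toLp 2 r ≠ 0 := by simpa using hr
  rw [direction, norm_smul, norm_inv, norm_norm, inv_mul_cancel₀ (norm_ne_zero_iff.2 this)]

lemma cvStatistic_smul {c : ℝ} (hc : c ≠ 0) (e : Fin n → ℝ) :
    cvStatistic (c • e) = cvStatistic e := by
  have hm : meanSq (c • e) = c ^ 2 * meanSq e := by
    simp only [meanSq, Pi.smul_apply, smul_eq_mul, mul_pow, ← Finset.mul_sum]
    ring
  have hs : ∑ i, ((c • e) i ^ 2 - c ^ 2 * meanSq e) ^ 2
      = c ^ 4 * ∑ i, (e i ^ 2 - meanSq e) ^ 2 := by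
    rw [Finset.mul_sum]
    refine Finset.sum_congr rfl fun i _ => ?_
    simp only [Pi.smul_apply, smul_eq_mul]
    ring
  rw [cvStatistic, hm, hs, cvStatistic]
  have : (n : ℝ) * (c ^ 2 * meanSq e) ^ 2 = c ^ 4 * (n * meanSq e ^ 2) := by ring
  rw [this, one_div, one_div, mul_inv]
  field_simp

lemma cvStatistic_direction {r : Fin n → ℝ} (hr : r ≠ 0) :
    cvStatistic (direction r : Fin n → ℝ) = cvStatistic r := by
  have : WithLp.toLp 2 r ≠ 0 := by simpa using hr
  exact cvStatistic_smul (inv_ne_zero (norm_ne_zero_iff.2 this)) r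

lemma inner_direction_mulVec {O : Matrix (Fin n) (Fin n) ℝ} (hO : O.transpose * O = 1)
    (r : Fin n → ℝ) {s t : EuclideanSpace ℝ (Fin n)} (hst : O.mulVec s = t) :
    inner ℝ (direction (O.mulVec r)) t = inner ℝ (direction r) s := by
  have hnorm : ‖WithLp.toLp 2 (O.mulVec r)‖ = ‖WithLp.toLp 2 r‖ := by
    rw [EuclideanSpace.norm_eq, EuclideanSpace.norm_eq]
    simp [sum_sq_mulVec hO]
  have hdot : O.mulVec r ⬝ᵥ O.mulVec s = r ⬝ᵥ s := by
    rw [Matrix.dotProduct_mulVec, Matrix.vecMul_mulVec, hO, Matrix.vecMul_one]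
  have hin (v : Fin n → ℝ) (w : EuclideanSpace ℝ (Fin n)) :
      inner ℝ (WithLp.toLp 2 v) w = v ⬝ᵥ w := by
    simp [PiLp.inner_apply, dotProduct, mul_comm]
  rw [direction, direction, inner_smul_left, inner_smul_left, hnorm, hin, hin, ← hst, hdot]

lemma charFun_map_direction_radial {μ : Measure (Fin n → ℝ)}
    (hμ : ∀ O : Matrix (Fin n) (Fin n) ℝ, O.transpose * O = 1 → μ.map O.mulVec = μ)
    {s t : EuclideanSpace ℝ (Fin n)} (hst : ‖s‖ = ‖t‖) :
    charFun (μ.map direction) s = charFun (μ.map direction) t := by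
  obtain ⟨O, hO, hOs⟩ := exists_orthogonal_mulVec_eq hst
  have hOm : Measurable O.mulVec := by fun_prop
  rw [charFun_apply, charFun_apply, integral_map measurable_direction.aemeasurable (by fun_prop),
    integral_map measurable_direction.aemeasurable (by fun_prop)]
  conv_rhs => rw [← hμ O hO]
  rw [integral_map hOm.aemeasurable]
  · simp_rw [inner_direction_mulVec hO _ hOs]
  · have := measurable_direction (n := n)
    exact Measurable.aestronglyMeasurable (by fun_prop)

/-- The direction of a rotation-invariant random vector is uniform on the sphere, whatever the law
of its length; so the law of the scale-invariant coefficient of variation statistic is the same for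
all such vectors. -/
theorem map_cvStatistic_eq_of_rotation_invariant {μ ν : Measure (Fin n → ℝ)}
    [IsProbabilityMeasure μ] [IsProbabilityMeasure ν]
    (hμ : ∀ O : Matrix (Fin n) (Fin n) ℝ, O.transpose * O = 1 → μ.map O.mulVec = μ)
    (hν : ∀ O : Matrix (Fin n) (Fin n) ℝ, O.transpose * O = 1 → ν.map O.mulVec = ν)
    (hμ0 : ∀ᵐ r ∂μ, r ≠ 0) (hν0 : ∀ᵐ r ∂ν, r ≠ 0) :
    μ.map cvStatistic = ν.map cvStatistic := by
  have hd := measurable_direction (n := n)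
  have hcv : Measurable fun v : EuclideanSpace ℝ (Fin n) => cvStatistic (v : Fin n → ℝ) :=
    measurable_cvStatistic.comp (by fun_prop)
  have hdir {ρ : Measure (Fin n → ℝ)} (hρ0 : ∀ᵐ r ∂ρ, r ≠ 0) :
      ρ.map cvStatistic = (ρ.map direction).map
        fun v : EuclideanSpace ℝ (Fin n) => cvStatistic (v : Fin n → ℝ) := by
    rw [Measure.map_map hcv hd]
    refine Measure.map_congr ?_
    filter_upwards [hρ0] with r hr using (cvStatistic_direction hr).symm
  have h1 {ρ : Measure (Fin n → ℝ)} (hρ0 : ∀ᵐ r ∂ρ, r ≠ 0) :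
      ∀ᵐ v ∂(ρ.map direction), ‖v‖ = 1 := by
    rw [ae_map_iff hd.aemeasurable (measurableSet_eq_fun (by fun_prop) (by fun_prop))]
    filter_upwards [hρ0] with r hr using norm_direction hr
  have := Measure.isProbabilityMeasure_map (μ := μ) hd.aemeasurable
  have := Measure.isProbabilityMeasure_map (μ := ν) hd.aemeasurable
  rw [hdir hμ0, hdir hν0, eq_of_charFun_radial_of_norm_eq_one
    (fun _ _ => charFun_map_direction_radial hμ) (fun _ _ => charFun_map_direction_radial hν)
    (h1 hμ0) (h1 hν0)]

end Direction

/-! ### The finite-sample law of the statistic of the Lasso residuals -/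

section Model

variable {n p : ℕ} {lam : ℝ}

/-- The Lasso residuals as a function of the design and of the standardized errors, under
homoskedasticity. -/
noncomputable def nullResidual (hlam : 0 < lam) (σ₀ : ℝ) (β₀ : EuclideanSpace ℝ (Fin p))
    (z : (Fin n → EuclideanSpace ℝ (Fin p)) × (Fin n → ℝ)) : Fin n → ℝ :=
  lassoResidual hlam (z.1, fun i => inner ℝ (z.1 i) β₀ + σ₀ * z.2 i)

variable {hlam : 0 < lam} {σ₀ : ℝ} {β₀ : EuclideanSpace ℝ (Fin p)}

lemma measurable_nullResidual : Measurable (nullResidual (n := n) hlam σ₀ β₀) := by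
  have h := continuous_lassoResidual (n := n) (p := p) hlam
  refine Continuous.measurable ?_
  exact h.comp (by fun_prop)

lemma nullResidual_rowMul {O : Matrix (Fin n) (Fin n) ℝ} (hO : O.transpose * O = 1)
    (z : (Fin n → EuclideanSpace ℝ (Fin p)) × (Fin n → ℝ)) :
    nullResidual hlam σ₀ β₀ (Prod.map (rowMul O) (rowMul O) z)
      = O.mulVec (nullResidual hlam σ₀ β₀ z) := by
  rw [nullResidual, nullResidual, ← lassoResidual_rowMul hlam hO]
  congr 2
  ext i
  have h : (fun i => inner ℝ (z.1 i) β₀ + σ₀ * z.2 i)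
      = (fun i => inner ℝ (z.1 i) β₀) + σ₀ • z.2 := rfl
  rw [h, Matrix.mulVec_add, Matrix.mulVec_smul]
  simp [inner_rowMul, rowMul_eq_mulVec]

lemma ae_pi_gaussianReal_ne (hn : n ≠ 0) (v : Fin n → ℝ) :
    ∀ᵐ u ∂(Measure.pi fun _ : Fin n => gaussianReal 0 1), u ≠ v := by
  have := nullSingletonClass_gaussianReal (μ := 0) (v := 1) one_ne_zero
  filter_upwards [Measure.ae_eval_ne (μ := fun _ : Fin n => gaussianReal 0 1)
    ⟨0, Nat.pos_of_ne_zero hn⟩ (v _)] with u hu h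
  exact hu (congrFun h _)

/-- Given the design, the response has a nonatomic law, so it does not vanish and the Lasso does not
interpolate it. -/
lemma ae_nullResidual_ne_zero (hn : n ≠ 0) (hσ₀ : 0 < σ₀)
    (G : Measure (Fin n → EuclideanSpace ℝ (Fin p))) [IsProbabilityMeasure G] :
    ∀ᵐ z ∂(G.prod (Measure.pi fun _ : Fin n => gaussianReal 0 1)),
      nullResidual hlam σ₀ β₀ z ≠ 0 := by
  have hmeas : MeasurableSet {z | nullResidual (n := n) hlam σ₀ β₀ z ≠ 0} :=
    (measurableSet_eq_fun measurable_nullResidual measurable_const).compl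
  rw [Measure.ae_prod_iff_ae_ae hmeas]
  refine ae_of_all _ fun x => ?_
  filter_upwards [ae_pi_gaussianReal_ne hn fun i => -inner ℝ (x i) β₀ / σ₀] with u hu
  refine lassoResidual_ne_zero hlam fun h => hu (funext fun i => ?_)
  have := congrFun h i
  simp only [Pi.zero_apply] at this
  field_simp
  linarith

lemma map_mulVec_pi_gaussianReal {O : Matrix (Fin n) (Fin n) ℝ} (hO : O.transpose * O = 1) :
    (Measure.pi fun _ : Fin n => gaussianReal 0 1).map O.mulVec
      = Measure.pi fun _ => gaussianReal 0 1 := by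
  have h := map_rowMul_pi (n := n) (μ := gaussianReal 0 1) (by simp) (mul_eq_one_comm.1 hO)
  rwa [show (rowMul O : (Fin n → ℝ) → _) = O.mulVec from funext (rowMul_eq_mulVec O)] at h

/-- In finite samples the statistic of the Lasso residuals has the same law as that of an i.i.d.
standard normal sample. -/
theorem map_cvStatistic_nullResidual (hσ₀ : 0 < σ₀)
    (G : Measure (EuclideanSpace ℝ (Fin p))) [IsGaussian G] (hG : ∫ x, x ∂G = 0) :
    ((Measure.pi fun _ : Fin n => G).prod (Measure.pi fun _ : Fin n => gaussianReal 0 1)).map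
        (fun z => cvStatistic (nullResidual hlam σ₀ β₀ z))
      = (Measure.pi fun _ : Fin n => gaussianReal 0 1).map cvStatistic := by
  rcases eq_or_ne n 0 with rfl | hn
  · have h : (cvStatistic : (Fin 0 → ℝ) → ℝ) = fun _ => 0 := by
      ext e; simp [cvStatistic]
    rw [h]
    simp [Measure.map_const]
  have hF := measurable_nullResidual (n := n) (hlam := hlam) (σ₀ := σ₀) (β₀ := β₀)
  have hprob := Measure.isProbabilityMeasure_map (μ := (Measure.pi fun _ : Fin n => G).prod
    (Measure.pi fun _ : Fin n => gaussianReal 0 1)) hF.aemeasurable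
  rw [← map_cvStatistic_eq_of_rotation_invariant (μ := ((Measure.pi fun _ : Fin n => G).prod
    (Measure.pi fun _ : Fin n => gaussianReal 0 1)).map (nullResidual hlam σ₀ β₀)) ?_
    (fun O hO => map_mulVec_pi_gaussianReal hO) ?_ (ae_pi_gaussianReal_ne hn 0),
    Measure.map_map measurable_cvStatistic hF]
  · rfl
  · intro O hO
    have hO' := mul_eq_one_comm.1 hO
    have hr1 := measurable_rowMul (E := EuclideanSpace ℝ (Fin p)) O
    have hr2 := measurable_rowMul (E := ℝ) O
    rw [Measure.map_map (by fun_prop) hF,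
      show O.mulVec ∘ nullResidual hlam σ₀ β₀
        = nullResidual hlam σ₀ β₀ ∘ Prod.map (rowMul O) (rowMul O) from
        funext fun z => (nullResidual_rowMul hO z).symm,
      ← Measure.map_map hF (hr1.prodMap hr2), ← Measure.map_prod_map _ _ hr1 hr2,
      map_rowMul_pi hG hO', map_rowMul_pi (by simp) hO']
  · rw [ae_map_iff (p := fun r => r ≠ 0) hF.aemeasurable
      (measurableSet_eq_fun measurable_id measurable_const).compl]
    exact ae_nullResidual_ne_zero hn hσ₀ _

end Model

/-- Convergence in distribution only depends on the laws. -/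
lemma MeasureTheory.TendstoInDistribution.of_identDistrib {Ω Ω' : ℕ → Type*} {Ω'' : Type*}
    [∀ n, MeasurableSpace (Ω n)] [∀ n, MeasurableSpace (Ω' n)] [MeasurableSpace Ω'']
    {μ : ∀ n, Measure (Ω n)} [∀ n, IsProbabilityMeasure (μ n)]
    {ν : ∀ n, Measure (Ω' n)} [∀ n, IsProbabilityMeasure (ν n)]
    {ρ : Measure Ω''} [IsProbabilityMeasure ρ] {X : ∀ n, Ω n → ℝ} {Y : ∀ n, Ω' n → ℝ}
    {Z : Ω'' → ℝ} {l : Filter ℕ} (h : TendstoInDistribution X l Z μ ρ)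
    (hXY : ∀ n, IdentDistrib (Y n) (X n) (ν n) (μ n)) : TendstoInDistribution Y l Z ν ρ where
  forall_aemeasurable n := (hXY n).aemeasurable_fst
  aemeasurable_limit := h.aemeasurable_limit
  tendsto := by
    refine h.tendsto.congr fun n => Subtype.ext ?_
    exact (hXY n).map_eq.symm

theorem theorem1
    (p : ℕ → ℕ) (Ω : ℕ → Type*) [∀ n, MeasurableSpace (Ω n)]
    (P : ∀ n, Measure (Ω n)) [∀ n, IsProbabilityMeasure (P n)]
    (M : ∀ n, RegressionModel n (p n) (Ω n))
    (S : ∀ n, Matrix (Fin (p n)) (Fin (p n)) ℝ)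
    (κ Cmin Cmax σ₀ : ℝ) (hκ₀ : 0 < κ) (hκ₁ : κ < 1)
    (hCmin : 0 < Cmin) (hCmax : 0 < Cmax) (hσ₀ : 0 < σ₀)
    -- the dimension
    (hp : ∀ᶠ n : ℕ in atTop, κ * (n : ℝ) < (p n : ℝ))
    (hlog : Tendsto (fun n : ℕ => Real.log (p n) / (n : ℝ)) atTop (𝓝 0))
    -- the errors, the covariates, the sparsity, the null hypothesis
    (herr : ∀ n, (M n).GaussianErrors (P n))
    (hdes : ∀ n, (M n).GaussianDesign (P n) (S n) Cmin Cmax)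
    (hs : (fun n : ℕ => ((M n).s₀ : ℝ)) =o[atTop]
      fun n : ℕ => √(n : ℝ) / Real.log (p n) ^ 2)
    (hH₀ : ∀ n, (M n).Homoskedastic σ₀)
    -- the tuning parameter
    (lam : ℕ → ℝ) (hlam_pos : ∀ n, 0 < lam n)
    (hlam : lam =Θ[atTop] fun n : ℕ => √(Real.log (p n) / (n : ℝ)))
    -- the Lasso estimator
    (βhat : ∀ n, Ω n → EuclideanSpace ℝ (Fin (p n)))
    (hβhat : ∀ n, ∀ᵐ ω ∂(P n), IsLassoEstimate (lam n) (fun i => (M n).X i ω)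
      (fun i => (M n).Y i ω) (βhat n ω)) :
    TendstoInDistribution
      (fun (n : ℕ) (ω : Ω n) => √(n : ℝ) *
        (cvStatistic (regResidual (fun i => (M n).X i ω) (fun i => (M n).Y i ω) (βhat n ω)) - 2))
      atTop (id : ℝ → ℝ) P (gaussianReal 0 24) := by
  obtain ⟨Ω', _, P', g, -, hg, hgind, _⟩ := exists_iid ℕ (gaussianReal 0 1)
  refine (tendstoInDistribution_cvStatistic_gaussian hg hgind).of_identDistrib fun n => ?_
  refine IdentDistrib.comp (u := fun t : ℝ => √(n : ℝ) * (t - 2)) (f := fun ω => cvStatistic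
    (regResidual (fun i => (M n).X i ω) (fun i => (M n).Y i ω) (βhat n ω)))
    (g := fun ω => cvStatistic fun i : Fin n => g i ω) ?_ (by fun_prop)
  obtain ⟨ξ, hε, hξind, hξ, hindep⟩ := herr n
  obtain ⟨hXind, hX, -, -⟩ := hdes n
  have hXm : AEMeasurable (fun ω i => (M n).X i ω) (P n) :=
    aemeasurable_pi_lambda _ fun i => (hX i).aemeasurable
  have hξm : AEMeasurable (fun ω i => ξ i ω) (P n) :=
    aemeasurable_pi_lambda _ fun i => (hξ i).aemeasurable
  have hgm : AEMeasurable (fun ω (i : Fin n) => g i ω) P' :=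
    aemeasurable_pi_lambda _ fun i => (hg i).aemeasurable
  -- the joint law of the design and the standardized errors
  have hlaw : (P n).map (fun ω => ((fun i => (M n).X i ω), fun i => ξ i ω))
      = (Measure.pi fun _ : Fin n => multivariateGaussian 0 (S n)).prod
        (Measure.pi fun _ : Fin n => gaussianReal 0 1) := by
    rw [(indepFun_iff_map_prod_eq_prod_map_map hXm hξm).1 hindep.symm,
      (iIndepFun_iff_map_fun_eq_pi_map fun i => (hX i).aemeasurable).1 hXind,
      (iIndepFun_iff_map_fun_eq_pi_map fun i => (hξ i).aemeasurable).1 hξind]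
    simp_rw [(hX _).map_eq, (hξ _).map_eq]
  have hglaw : P'.map (fun ω (i : Fin n) => g i ω) = Measure.pi fun _ => gaussianReal 0 1 := by
    rw [(iIndepFun_iff_map_fun_eq_pi_map (f := fun i : Fin n => g i)
      fun i => (hg i).aemeasurable).1 (hgind.precomp Fin.val_injective)]
    simp_rw [(hg _).map_eq]
  have hcvm : Measurable fun z => cvStatistic
      (nullResidual (n := n) (hlam_pos n) σ₀ (M n).β₀ z) :=
    measurable_cvStatistic.comp measurable_nullResidual
  have hres : (fun ω => cvStatistic (regResidual (fun i => (M n).X i ω) (fun i => (M n).Y i ω)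
      (βhat n ω))) =ᵐ[P n] fun ω => cvStatistic (nullResidual (hlam_pos n) σ₀ (M n).β₀
        ((fun i => (M n).X i ω), fun i => ξ i ω)) := by
    filter_upwards [hβhat n, ae_all_iff.2 hε] with ω hω hεω
    rw [hω.regResidual_eq_lassoResidual (hlam_pos n), nullResidual]
    simp only [RegressionModel.Y, hεω, hH₀ n _]
  refine ⟨(hcvm.comp_aemeasurable (hXm.prodMk hξm)).congr hres.symm,
    measurable_cvStatistic.comp_aemeasurable hgm, ?_⟩
  have h1 := AEMeasurable.map_map_of_aemeasurable (μ := P n) hcvm.aemeasurable (hXm.prodMk hξm)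
  have h2 := AEMeasurable.map_map_of_aemeasurable (μ := P')
    (measurable_cvStatistic (n := n)).aemeasurable hgm
  rw [hlaw, map_cvStatistic_nullResidual hσ₀ _ integral_id_multivariateGaussian] at h1
  rw [hglaw] at h2
  rw [Measure.map_congr hres]
  exact h1.symm.trans h2
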